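/- Let $d\ge 1$. For $f:\mathbb{Z}^d\to\mathbb{R}$ in $\ell^1(\mathbb{Z}^d)$, let $$\widetilde M f(n)=\sup_{Q\ni n}\frac{1}{|Q\cap\mathbb{Z}^d|}\sum_{m\in Q\cap\mathbb{Z}^d}|f(m)|,\qquad n\in\mathbb{Z}^d,$$ where the supremum is over all closed cubes $Q=\{x\in\mathbb{R}^d:\|x-x_0\|_\infty\le r\}$ with $x_0\in\mathbb{R}^d$, $r\ge 0$ and $n\in Q$, and for $g:\mathbb{Z}^d\to\mathbb{R}$ let $$\operatorname{Var} g=\sum_{i=1}^d\sum_{n\in\mathbb{Z}^d}|g(n+e_i)-g(n)|\in[0,\infty],$$ where $e_1,\dots,e_d$ are the canonical basis vectors. Put $$\widetilde C(d)=2d\left(1+\sum_{k\ge 1}\frac1k\left[\left(\frac{2}{k+1}+\frac{2k-1}{k}\right)^{d-1}-\left(\frac{2k-1}{k}\right)^{d-1}\right]\right).$$ This series converges, and for every $f\in\ell^1(\mathbb{Z}^d)$, $$\operatorname{Var}\widetilde M f\le \widetilde C(d)\,\|f\|_{\ell^1(\mathbb{Z}^d)}.$$ The constant $\widetilde C(d)$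 is the best possible: if $C\in\mathbb{R}$ is such that $\operatorname{Var}\widetilde M f\le C\|f\|_{\ell^1(\mathbb{Z}^d)}$ for all $f\in\ell^1(\mathbb{Z}^d)$, then $\widetilde C(d)\le C$. Moreover, for $f\in\ell^1(\mathbb{Z}^d)$, equality $\operatorname{Var}\widetilde M f=\widetilde C(d)\|f\|_{\ell^1(\mathbb{Z}^d)}$ holds if and only if $f$ is a delta function, that is, there are $p\in\mathbb{Z}^d$ and $k\in\mathbb{R}$ with $f(p)=k$ and $f(n)=0$ for all $n\ne p$. In particular, $\widetilde C(1)=2$ and $\widetilde C(2)=12$. -/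

import Mathlib

open scoped ENNReal

/-- The lattice point `n ∈ ℤ^d` as a point of `ℝ^d`; `Fin d → ℝ` carries the sup norm, so that
`Metric.closedBall x₀ r` is the closed cube with centre `x₀` and half-side `r`. -/
def latticePoint {d : ℕ} (n : Fin d → ℤ) : Fin d → ℝ := fun i => (n i : ℝ)

theorem finite_latticePoint_mem_closedBall {d : ℕ} (x₀ : Fin d → ℝ) (r : ℝ) :
    {m : Fin d → ℤ | latticePoint m ∈ Metric.closedBall x₀ r}.Finite := by
  refine (Set.finite_Icc (fun i => ⌈x₀ i - r⌉) (fun i => ⌊x₀ i + r⌋)).subset ?_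
  intro m hm
  have key : ∀ i, |(m i : ℝ) - x₀ i| ≤ r := fun i => by
    have h := (dist_le_pi_dist (latticePoint m) x₀ i).trans (Metric.mem_closedBall.mp hm)
    simpa [latticePoint, Real.dist_eq] using h
  refine ⟨fun i => Int.ceil_le.mpr ?_, fun i => Int.le_floor.mpr ?_⟩
  · linarith [(abs_le.mp (key i)).1]
  · linarith [(abs_le.mp (key i)).2]

/-- The lattice points of the closed cube with centre `x₀ ∈ ℝ^d` and half-side `r`. -/
noncomputable def cubePoints {d : ℕ} (x₀ : Fin d → ℝ) (r : ℝ) : Finset (Fin d → ℤ) :=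
  (finite_latticePoint_mem_closedBall x₀ r).toFinset

/-- The average of `|f|` over the lattice points of a closed cube. -/
noncomputable def cubeAverage {d : ℕ} (f : (Fin d → ℤ) → ℝ) (x₀ : Fin d → ℝ) (r : ℝ) : ℝ :=
  (1 / ((cubePoints x₀ r).card : ℝ)) * ∑ m ∈ cubePoints x₀ r, |f m|

/-- The averages of `|f|` over all closed cubes (real centre, real half-side `r ≥ 0`)
that contain the lattice point `n`. -/
def cubeAverages {d : ℕ} (f : (Fin d → ℤ) → ℝ) (n : Fin d → ℤ) : Set ℝ :=
  {a | ∃ (x₀ : Fin d → ℝ) (r : ℝ), 0 ≤ r ∧ latticePoint n ∈ Metric.closedBall x₀ r ∧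
    a = cubeAverage f x₀ r}

/-- The uncentered discrete maximal function over cubes. -/
noncomputable def uncenteredMaximal {d : ℕ} (f : (Fin d → ℤ) → ℝ) (n : Fin d → ℤ) : ℝ :=
  sSup (cubeAverages f n)

theorem cubeAverages_nonempty {d : ℕ} (f : (Fin d → ℤ) → ℝ) (n : Fin d → ℤ) :
    (cubeAverages f n).Nonempty :=
  ⟨_, latticePoint n, 0, le_rfl, by simp, rfl⟩

/-- For summable `f` the supremum in `uncenteredMaximal` is a genuine one. -/
theorem bddAbove_cubeAverages {d : ℕ} (f : (Fin d → ℤ) → ℝ) (hf : Summable fun m => |f m|)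
    (n : Fin d → ℤ) : BddAbove (cubeAverages f n) := by
  refine ⟨∑' m, |f m|, ?_⟩
  rintro a ⟨x₀, r, -, -, rfl⟩
  have h1 : ∑ m ∈ cubePoints x₀ r, |f m| ≤ ∑' m, |f m| :=
    hf.sum_le_tsum _ fun _ _ => abs_nonneg _
  have h0 : 0 ≤ ∑ m ∈ cubePoints x₀ r, |f m| := Finset.sum_nonneg fun _ _ => abs_nonneg _
  refine le_trans ?_ h1
  refine mul_le_of_le_one_left h0 ?_
  rw [one_div]
  exact Nat.cast_inv_le_one _

/-- The total variation `∑_i ∑_n |g(n + e_i) - g(n)|`, with values in `[0, ∞]`. -/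
noncomputable def totalVariation {d : ℕ} (g : (Fin d → ℤ) → ℝ) : ℝ≥0∞ :=
  ∑ i : Fin d, ∑' n : Fin d → ℤ, ENNReal.ofReal |g (n + Pi.single i 1) - g n|

/-- `f` vanishes off a single point (its value there is arbitrary, possibly zero). -/
def IsDeltaFunction {d : ℕ} (f : (Fin d → ℤ) → ℝ) : Prop :=
  ∃ (p : Fin d → ℤ) (k : ℝ), f p = k ∧ ∀ n, n ≠ p → f n = 0

/-- The `k`-th term (`k ≥ 1`) of the series in the sharp constant. -/
noncomputable def sharpConstTerm (d : ℕ) (k : ℕ+) : ℝ :=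
  (1 / (k : ℝ)) * ((2 / ((k : ℝ) + 1) + (2 * (k : ℝ) - 1) / (k : ℝ)) ^ (d - 1)
    - ((2 * (k : ℝ) - 1) / (k : ℝ)) ^ (d - 1))

/-- The sharp constant in dimension `d ≥ 1`. -/
noncomputable def sharpConst (d : ℕ) : ℝ :=
  2 * (d : ℝ) * (1 + ∑' k : ℕ+, sharpConstTerm d k)

/-! Split the variation into lines parallel to the axes. A point `q` with transversal displacement
`m` from a line enters an average at a point of that line only through a cube that contains `q` and
meets the line. Such a cube has at least `lineCount m` lattice points, so `q` contributes at most
`|f q| * lineWeight m`. The core claim (`line_variation_le`) is that the variation along the line is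
at most twice the total of these contributions. Summing `lineWeight` over all parallel lines gives
the bracket in the constant (`tsum_lineWeight`), and the `d` directions and the factor 2 give `2 *
d`.

For the claim, let `g` be the maximal function on the line. The variation is at most twice the sum
of the peaks minus the valleys. The supremum at a peak is attained by a cube; on the interval it
cuts from the line `g` is at least the peak value, so the intervals of peaks separated by a lower
valley are disjoint. Each peak is thus paid for by the mass in its own slab. A left-to-right scan
makes this precise without listing the peaks.

For a delta function, `g` tends to 0 at both ends and attains the weight of the line, so equality
holds on every line. If the support contains `p` and `q` with `p i < q i`, the line through `p` in
direction `i` loses a fixed `δ > 0` (`partialVariation_add_le`, `line_variation_lt`), and strictness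
survives the summation because the total is finite. -/

/-! ### Variation along a line: peaks paid for by disjoint intervals -/

/-- The state of a left-to-right scan of `g` that is ascending at `B`: the variation `v` collected
so far is at most `2 * x + g B`, where the mass `x` lies to the left of every interval that ends
at `B` and on which `g` is at least `g B`. -/
def AscentState (g Φ : ℤ → ℝ) (v : ℝ) (B : ℤ) (x : ℝ) : Prop :=
  v ≤ 2 * x + g B ∧ ∀ l ≤ B, (∀ t, l ≤ t → t ≤ B → g B ≤ g t) → x ≤ Φ l

/-- Every value of `g` is paid for by the mass of an interval on which `g` is at least as large. -/
def IntervalDominated (g Φ : ℤ → ℝ) : Prop :=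
  ∀ a, ∃ l r, l ≤ a ∧ a ≤ r ∧ (∀ t, l ≤ t → t ≤ r → g a ≤ g t) ∧ Φ l + g a ≤ Φ (r + 1)

section Line

variable {g Φ : ℤ → ℝ}

theorem AscentState.step_up {v x : ℝ} {B : ℤ} (hΦ : Monotone Φ) (h : AscentState g Φ v B x)
    (hup : g B ≤ g (B + 1)) : AscentState g Φ (v + |g (B + 1) - g B|) (B + 1) x := by
  obtain ⟨h1, h2⟩ := h
  refine ⟨?_, fun l hl hlt => ?_⟩
  · rw [abs_of_nonneg (by linarith)]; linarith
  · rcases hl.lt_or_eq with hl | rfl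
    · exact h2 l (by omega) fun t ht ht' => hup.trans (hlt t ht (by omega))
    · refine (h2 B le_rfl fun t ht ht' => ?_).trans (hΦ (by omega))
      rw [le_antisymm ht' ht]

/-- `B` is a peak: an interval that pays for `g B` cannot contain `B + 1`, so it ends at `B`, and
its left end `l` satisfies `x ≤ Φ l`. Hence `x + g B ≤ Φ (B + 1)`. -/
theorem AscentState.step_down {v x : ℝ} {B : ℤ} (hdom : IntervalDominated g Φ)
    (h : AscentState g Φ v B x) (hdown : g (B + 1) < g B) :
    v + |g (B + 1) - g B| + g (B + 1) ≤ 2 * Φ (B + 1) := by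
  obtain ⟨h1, h2⟩ := h
  obtain ⟨l, r, hl, hr, hlr, hm⟩ := hdom B
  have hrB : r = B := by
    by_contra hne
    exact absurd (hlr (B + 1) (by omega) (by omega)) (not_le.mpr hdown)
  subst hrB
  have := h2 l hl fun t ht ht' => hlr t ht ht'
  rw [abs_of_neg (by linarith)]
  linarith

/-- `B` is a valley: intervals on which `g` is at least `g (B + 1)` stop short of `B`, so all mass
left of `B` may be reserved. The term `2 * g B` is slack that the plain bound discards and the
strict one uses. -/
theorem ascentState_of_descent {v : ℝ} {B : ℤ} (hΦ : Monotone Φ)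
    (h : v + g B ≤ 2 * Φ B) (hup : g B < g (B + 1)) :
    AscentState g Φ (v + 2 * g B + |g (B + 1) - g B|) (B + 1) (Φ B) := by
  refine ⟨?_, fun l hl hlt => ?_⟩
  · rw [abs_of_pos (by linarith)]; linarith
  · apply hΦ
    by_contra hne
    exact absurd (hlt B (by omega) (by omega)) (not_le.mpr hup)

theorem AscentState.mono {v v' x : ℝ} {B : ℤ} (h : AscentState g Φ v B x) (hv : v' ≤ v) :
    AscentState g Φ v' B x := ⟨hv.trans h.1, h.2⟩

theorem descent_step {v : ℝ} {B : ℤ} (hΦ : Monotone Φ)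
    (h : v + g B ≤ 2 * Φ B) (hdown : g (B + 1) ≤ g B) :
    v + |g (B + 1) - g B| + g (B + 1) ≤ 2 * Φ (B + 1) := by
  have := hΦ (show B ≤ B + 1 by omega)
  rw [abs_of_nonpos (by linarith)]
  linarith

/-- The variation over `[A, A + N]`, increased by `g A`. -/
def partialVariation (g : ℤ → ℝ) (A : ℤ) (N : ℕ) : ℝ :=
  g A + ∑ j ∈ Finset.range N, |g (A + j + 1) - g (A + j)|

theorem partialVariation_succ (g : ℤ → ℝ) (A : ℤ) (N : ℕ) :
    partialVariation g A (N + 1) =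
      partialVariation g A N + |g (A + N + 1) - g (A + N)| := by
  simp [partialVariation, Finset.sum_range_succ, add_assoc]

theorem ascent_or_descent_step (hg : ∀ t, 0 ≤ g t) (hΦ : Monotone Φ)
    (hdom : IntervalDominated g Φ) {v : ℝ} {B : ℤ}
    (h : v + g B ≤ 2 * Φ B ∨ ∃ x, AscentState g Φ v B x) :
    v + |g (B + 1) - g B| + g (B + 1) ≤ 2 * Φ (B + 1) ∨
      ∃ x, AscentState g Φ (v + |g (B + 1) - g B|) (B + 1) x := by
  rcases h with h | ⟨x, h⟩
  · rcases le_or_gt (g (B + 1)) (g B) with hd | hu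
    · exact .inl (descent_step hΦ h hd)
    · exact .inr ⟨_, (ascentState_of_descent hΦ h hu).mono (by linarith [hg B])⟩
  · rcases le_or_gt (g B) (g (B + 1)) with hu | hd
    · exact .inr ⟨x, h.step_up hΦ hu⟩
    · exact .inl (h.step_down hdom hd)

/-- The summand `g A` in `partialVariation` acts as an ascent from 0, so the scan starts ascending
with no mass spent. -/
theorem ascentState_start (hΦ0 : ∀ t, 0 ≤ Φ t) (A : ℤ) :
    AscentState g Φ (partialVariation g A 0) A 0 := by
  refine ⟨by simp [partialVariation], fun l _ _ => hΦ0 l⟩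

theorem ascent_or_descent (hg : ∀ t, 0 ≤ g t) (hΦ : Monotone Φ) (hΦ0 : ∀ t, 0 ≤ Φ t)
    (hdom : IntervalDominated g Φ) (A : ℤ) (N : ℕ) :
    partialVariation g A N + g (A + N) ≤ 2 * Φ (A + N) ∨
      ∃ x, AscentState g Φ (partialVariation g A N) (A + N) x := by
  induction N with
  | zero => exact .inr ⟨0, by simpa using ascentState_start hΦ0 A⟩
  | succ N ih =>
    rw [partialVariation_succ, Nat.cast_succ, ← add_assoc]
    exact ascent_or_descent_step hg hΦ hdom ih

theorem le_of_ascent_or_descent {T : ℝ} (hg : ∀ t, 0 ≤ g t)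
    (hT : ∀ t, Φ t ≤ T) (hdom : IntervalDominated g Φ) {v : ℝ} {B : ℤ}
    (h : v + g B ≤ 2 * Φ B ∨ ∃ x, AscentState g Φ v B x) : v ≤ 2 * T := by
  rcases h with h | ⟨x, h⟩
  · linarith [hg B, hT B]
  · obtain ⟨l, r, hl, hr, hlr, hm⟩ := hdom B
    linarith [h.1, h.2 l hl fun t ht ht' => hlr t ht (by omega), hT (r + 1), hT l]

theorem partialVariation_le {T : ℝ} (hg : ∀ t, 0 ≤ g t) (hΦ : Monotone Φ) (hΦ0 : ∀ t, 0 ≤ Φ t)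
    (hT : ∀ t, Φ t ≤ T) (hdom : IntervalDominated g Φ) (A : ℤ) (N : ℕ) :
    partialVariation g A N ≤ 2 * T :=
  le_of_ascent_or_descent hg hT hdom (ascent_or_descent hg hΦ hΦ0 hdom A N)

/-- Strict form of the bound. Between `p` and `q` the scan either turns at a valley of height at
least `δ / 2`, or descends past `q` without spending the mass there, or reaches `q` in an ascent
that began before `p`; then the next peak's interval can be extended back to `p`, and `hgain`
supplies `δ`. -/
theorem partialVariation_add_le {T δ : ℝ} {p q : ℤ} (hg : ∀ t, 0 ≤ g t) (hΦ : Monotone Φ)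
    (hΦ0 : ∀ t, 0 ≤ Φ t) (hT : ∀ t, Φ t ≤ T) (hdom : IntervalDominated g Φ) (hpq : p < q)
    (hmin : ∀ t, p ≤ t → t ≤ q → δ ≤ 2 * g t) (hq : Φ q + δ ≤ Φ (q + 1)) (hδ : 0 ≤ δ)
    (hgain : ∀ a, q ≤ a → ∃ l r, l ≤ a ∧ a ≤ r ∧ (∀ t, l ≤ t → t ≤ r → g a ≤ g t) ∧
      Φ (min l p) + g a + δ ≤ Φ (r + 1))
    {A : ℤ} {N : ℕ} (hA : A ≤ p) (hN : q < A + N) :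
    partialVariation g A N + δ ≤ 2 * T := by
  obtain ⟨N₀, hN₀⟩ := Int.eq_ofNat_of_zero_le (sub_nonneg.mpr hA)
  obtain rfl : p = A + N₀ := by omega
  -- after `p`: slack already gained, or one ascent since before `p`, or a descent before `q`
  have key : ∀ n : ℕ, ∀ B : ℤ, B = A + N₀ + n →
      (partialVariation g A (N₀ + n) + δ + g B ≤ 2 * Φ B ∨
        ∃ x, AscentState g Φ (partialVariation g A (N₀ + n) + δ) B x) ∨
      (∃ x, AscentState g Φ (partialVariation g A (N₀ + n)) B x ∧ x ≤ Φ (A + N₀)) ∨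
      (B ≤ q ∧ partialVariation g A (N₀ + n) + g B ≤ 2 * Φ B) := by
    intro n
    induction n with
    | zero =>
      rintro B rfl
      simp only [Nat.cast_zero, add_zero]
      rcases ascent_or_descent hg hΦ hΦ0 hdom A N₀ with h | ⟨x, h⟩
      · exact .inr (.inr ⟨hpq.le, h⟩)
      · refine .inr (.inl ⟨x, h, h.2 _ le_rfl fun t ht ht' => ?_⟩)
        rw [le_antisymm ht' ht]
    | succ n ih =>
      rintro B' rfl
      obtain ⟨B, hB⟩ : ∃ B : ℤ, B = A + N₀ + n := ⟨_, rfl⟩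
      have hBs : A + (N₀ : ℤ) + ((n + 1 : ℕ) : ℤ) = B + 1 := by push_cast; omega
      have hv : partialVariation g A (N₀ + (n + 1)) =
          partialVariation g A (N₀ + n) + |g (B + 1) - g B| := by
        rw [← add_assoc, partialVariation_succ, hB]; push_cast; simp only [add_assoc]
      rw [hBs, hv]
      generalize partialVariation g A (N₀ + n) = v at *
      rcases ih B hB with h | ⟨x, h, hx⟩ | ⟨hBq, h⟩
      · left
        rw [add_right_comm v]
        exact ascent_or_descent_step hg hΦ hdom h
      · rcases le_or_gt (g B) (g (B + 1)) with hu | hd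
        · exact .inr (.inl ⟨x, h.step_up hΦ hu, hx⟩)
        · rcases lt_or_ge B q with hlt | hge
          · exact .inr (.inr ⟨by omega, h.step_down hdom hd⟩)
          -- First peak at or after `q` with no valley since `p`: the reserved mass lies left of
          -- both `l` and `p`.
          · left; left
            obtain ⟨l, r, hl, hr, hlr, hm⟩ := hgain B hge
            have hrB : r = B := by
              by_contra hne
              exact absurd (hlr (B + 1) (by omega) (by omega)) (not_le.mpr hd)
            subst hrB
            have hxl := h.2 l hl hlr
            have : x ≤ Φ (min l (A + N₀)) := by rcases min_choice l (A + N₀) with h | h <;> rwa [h]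
            rw [abs_of_neg (by linarith)]
            linarith [h.1]
      · rcases le_or_gt (g (B + 1)) (g B) with hd | hu
        · rcases hBq.lt_or_eq with hlt | rfl
          · exact .inr (.inr ⟨by omega, descent_step hΦ h hd⟩)
          -- Descending through `q`: the mass at `q` pays for nothing else.
          · left; left
            rw [abs_of_nonpos (by linarith)]
            linarith
        -- Valley inside `[p, q]`: the slack `2 * g B` is at least `δ`.
        · left; right
          exact ⟨_, (ascentState_of_descent hΦ h hu).mono
            (by linarith [hmin B (by omega) hBq])⟩
  obtain ⟨n, rfl⟩ : ∃ n : ℕ, N = N₀ + n := ⟨N - N₀, by omega⟩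
  have hB : q < A + N₀ + n := by push_cast at hN; omega
  rcases key n _ rfl with h | ⟨x, h, hx⟩ | ⟨hBq, h⟩
  · exact le_of_ascent_or_descent hg hT hdom h
  · obtain ⟨l, r, hl, hr, hlr, hm⟩ := hgain _ hB.le
    have hxl := h.2 l hl fun t ht ht' => hlr t ht (by omega)
    have : x ≤ Φ (min l (A + N₀)) := by rcases min_choice l (A + N₀) with h | h <;> rwa [h]
    linarith [h.1, hT (r + 1), hT (min l (A + N₀))]
  · omega

end Line

/-- Bounds on all partial variations bound the total variation along a line. -/
theorem tsum_ofReal_abs_sub_le {g : ℤ → ℝ} {T : ℝ} {p q : ℤ} (hg : ∀ t, 0 ≤ g t)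
    (h : ∀ (A : ℤ) (N : ℕ), A ≤ p → q < A + N → partialVariation g A N ≤ T) :
    ∑' t : ℤ, ENNReal.ofReal |g (t + 1) - g t| ≤ ENNReal.ofReal T := by
  rw [ENNReal.tsum_eq_iSup_sum]
  refine iSup_le fun s => ?_
  rw [← ENNReal.ofReal_sum_of_nonneg fun _ _ => abs_nonneg _]
  apply ENNReal.ofReal_le_ofReal
  obtain ⟨a, ha⟩ := s.bddBelow
  obtain ⟨b, hb⟩ := s.bddAbove
  -- Enlarging the window to cover `[p, q]` only adds nonnegative terms.
  set A := min a p with hA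
  set N := (max b q + 1 - A).toNat with hN
  refine le_trans ?_ (h A N (min_le_right _ _) (by omega))
  have hsub : s ⊆ (Finset.range N).image fun j : ℕ => A + (j : ℤ) := by
    intro t ht
    have h1 := ha (Finset.mem_coe.mpr ht)
    have h2 := hb (Finset.mem_coe.mpr ht)
    rw [Finset.mem_image]
    exact ⟨(t - A).toNat, by rw [Finset.mem_range]; omega, by omega⟩
  refine (Finset.sum_le_sum_of_subset_of_nonneg hsub fun _ _ _ => abs_nonneg _).trans ?_
  rw [Finset.sum_image fun x _ y _ hxy => by simpa using hxy]
  have := hg A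
  simp only [partialVariation]
  linarith

/-! ### Counting lattice points of cubes that meet a line -/

section Cubes

theorem mem_cubePoints {d : ℕ} {x₀ : Fin d → ℝ} {r : ℝ} (hr : 0 ≤ r) {m : Fin d → ℤ} :
    m ∈ cubePoints x₀ r ↔ ∀ j, |(m j : ℝ) - x₀ j| ≤ r := by
  simp [cubePoints, Metric.mem_closedBall, dist_pi_le_iff hr, latticePoint, Real.dist_eq]

theorem cubePoints_eq_piFinset {d : ℕ} {x₀ : Fin d → ℝ} {r : ℝ} (hr : 0 ≤ r) :
    cubePoints x₀ r = Fintype.piFinset fun j => Finset.Icc ⌈x₀ j - r⌉ ⌊x₀ j + r⌋ := by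
  ext m
  simp only [mem_cubePoints hr, Fintype.mem_piFinset, Finset.mem_Icc, Int.ceil_le, Int.le_floor,
    abs_le]
  exact forall_congr' fun j => ⟨fun h => ⟨by linarith, by linarith⟩,
    fun h => ⟨by linarith, by linarith⟩⟩

theorem card_cubePoints {d : ℕ} {x₀ : Fin d → ℝ} {r : ℝ} (hr : 0 ≤ r) :
    (cubePoints x₀ r).card = ∏ j, (⌊x₀ j + r⌋ + 1 - ⌈x₀ j - r⌉).toNat := by
  simp [cubePoints_eq_piFinset hr]

theorem natAbs_sub_lt_card {d : ℕ} {x₀ : Fin d → ℝ} {r : ℝ} (hr : 0 ≤ r) {p a : Fin d → ℤ}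
    (hp : p ∈ cubePoints x₀ r) (ha : a ∈ cubePoints x₀ r) (j : Fin d) :
    (p j - a j).natAbs < (cubePoints x₀ r).card := by
  have hdvd := Finset.dvd_prod_of_mem (fun j => (⌊x₀ j + r⌋ + 1 - ⌈x₀ j - r⌉).toNat)
    (Finset.mem_univ j)
  rw [← card_cubePoints hr] at hdvd
  refine lt_of_lt_of_le ?_ (Nat.le_of_dvd (Finset.card_pos.mpr ⟨p, hp⟩) hdvd)
  rw [cubePoints_eq_piFinset hr, Fintype.mem_piFinset] at hp ha
  have h1 := Finset.mem_Icc.mp (hp j)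
  have h2 := Finset.mem_Icc.mp (ha j)
  omega

/-- The sup norm of a lattice vector. -/
def latticeSupNorm {e : ℕ} (m : Fin e → ℤ) : ℕ := Finset.univ.sup fun j => (m j).natAbs

theorem natAbs_le_latticeSupNorm {e : ℕ} (m : Fin e → ℤ) (j : Fin e) :
    (m j).natAbs ≤ latticeSupNorm m :=
  Finset.le_sup (f := fun j => (m j).natAbs) (Finset.mem_univ j)

/-- The least number of lattice points of a cube that contains a given point and meets a given
line parallel to an axis, in terms of the displacement `m` transversal to the line. -/
def lineCount {e : ℕ} (m : Fin e → ℤ) : ℕ :=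
  max (latticeSupNorm m) 1 *
    ∏ j, if (m j).natAbs = latticeSupNorm m then latticeSupNorm m + 1 else latticeSupNorm m

theorem lineCount_pos {e : ℕ} (m : Fin e → ℤ) : 0 < lineCount m := by
  refine Nat.mul_pos (by simp) (Finset.prod_pos fun j _ => ?_)
  have := natAbs_le_latticeSupNorm m j
  split_ifs <;> omega

theorem lineCount_zero {e : ℕ} : lineCount (0 : Fin e → ℤ) = 1 := by
  have h : latticeSupNorm (0 : Fin e → ℤ) = 0 := by simp [latticeSupNorm]
  simp [lineCount, h]

/-- Let `k` be the transversal sup distance. The side length is at least `k`, and a closed interval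
that long contains at least `k` integers. Where the displacement is exactly `k`, both of its ends
are included, giving `k + 1`. -/
theorem lineCount_le_card {e : ℕ} (i : Fin (e + 1)) {x₀ : Fin (e + 1) → ℝ} {r : ℝ} (hr : 0 ≤ r)
    {p a : Fin (e + 1) → ℤ} (hp : p ∈ cubePoints x₀ r) (ha : a ∈ cubePoints x₀ r) :
    lineCount (i.removeNth p - i.removeNth a) ≤ (cubePoints x₀ r).card := by
  set m := i.removeNth p - i.removeNth a with hm
  have hside : ∀ j, (p j - a j).natAbs < (⌊x₀ j + r⌋ + 1 - ⌈x₀ j - r⌉).toNat := by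
    rw [cubePoints_eq_piFinset hr, Fintype.mem_piFinset] at hp ha
    intro j
    have h1 := Finset.mem_Icc.mp (hp j)
    have h2 := Finset.mem_Icc.mp (ha j)
    omega
  have hk : (latticeSupNorm m : ℝ) ≤ 2 * r := by
    have : latticeSupNorm m ≤ ⌊2 * r⌋₊ := by
      refine Finset.sup_le fun j _ => Nat.le_floor ?_
      have h1 := abs_le.mp ((mem_cubePoints hr).mp hp (i.succAbove j))
      have h2 := abs_le.mp ((mem_cubePoints hr).mp ha (i.succAbove j))
      have h3 : m j = p (i.succAbove j) - a (i.succAbove j) := rfl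
      rw [Nat.cast_natAbs, h3]
      push_cast
      rw [abs_le]
      constructor <;> linarith
    exact (Nat.le_floor_iff (by linarith)).mp this
  have hlong : ∀ j, latticeSupNorm m ≤ (⌊x₀ j + r⌋ + 1 - ⌈x₀ j - r⌉).toNat := by
    intro j
    have h1 := Int.lt_floor_add_one (x₀ j + r)
    have h2 := Int.ceil_lt_add_one (x₀ j - r)
    have h3 : ((latticeSupNorm m : ℤ) : ℝ) < ((⌊x₀ j + r⌋ + 1 - ⌈x₀ j - r⌉ + 1 : ℤ) : ℝ) := by
      push_cast
      linarith
    have h4 := Int.cast_lt.mp h3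
    omega
  rw [card_cubePoints hr, Fin.prod_univ_succAbove _ i, lineCount]
  refine Nat.mul_le_mul (max_le (hlong i) ?_) (Finset.prod_le_prod' fun j _ => ?_)
  · have := hside i
    omega
  · split_ifs with h
    · rw [← h]
      exact hside (i.succAbove j)
    · exact hlong _

/-- An interval of length `k` containing `0` and `x` with as few integers as possible. -/
theorem exists_interval_center (k : ℕ) (x : ℤ) (hx : x.natAbs ≤ k) :
    ∃ c : ℝ, |0 - c| ≤ k / 2 ∧ |(x : ℝ) - c| ≤ k / 2 ∧ ∀ z : ℤ,
      (⌊(z + c) + k / 2⌋ + 1 - ⌈(z + c) - k / 2⌉).toNat ≤ if x.natAbs = k then k + 1 else k := by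
  -- The integers in the interval about `c` lie in `[u, v - 1]`; a shift by the integer `z`
  -- preserves their number.
  have key : ∀ (c : ℝ) (N : ℕ) (u v : ℤ), v ≤ u + N → c + k / 2 < v → (u : ℝ) - 1 < c - k / 2 →
      ∀ z : ℤ, (⌊(z + c) + k / 2⌋ + 1 - ⌈(z + c) - k / 2⌉).toNat ≤ N := by
    intro c N u v huv hv hu z
    have h1 : ⌊((z : ℝ) + c) + k / 2⌋ < z + v := by
      rw [Int.floor_lt]; push_cast; linarith
    have h2 : z + u - 1 < ⌈((z : ℝ) + c) - k / 2⌉ := by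
      rw [Int.lt_ceil]; push_cast; linarith
    omega
  by_cases h : x.natAbs = k
  -- The interval has ends `0` and `x`.
  · refine ⟨x / 2, ?_, ?_, ?_⟩
    · rw [← h, Nat.cast_natAbs, zero_sub, abs_neg, abs_div, Int.cast_abs]; norm_num
    · rw [← h, Nat.cast_natAbs, Int.cast_abs, show (x : ℝ) - x / 2 = x / 2 by ring, abs_div]
      norm_num
    · rw [if_pos h]
      rcases le_total 0 x with hx0 | hx0
      · have hk : (x : ℝ) = k := by exact_mod_cast (show x = k by omega)
        refine key _ _ 0 (k + 1) (by push_cast; omega) ?_ ?_ <;> push_cast <;> linarith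
      · have hk : (x : ℝ) = -k := by exact_mod_cast (show x = -k by omega)
        refine key _ _ (-k) 1 (by push_cast; omega) ?_ ?_ <;> push_cast <;> linarith
  · rw [if_neg h]
    have hk1 : (1 : ℝ) ≤ k := by exact_mod_cast (show 1 ≤ k by omega)
    rcases le_total 0 x with hx0 | hx0
    · have h0 : (0 : ℝ) ≤ x := by exact_mod_cast hx0
      have h1 : (x : ℝ) ≤ k - 1 := by exact_mod_cast (show x ≤ k - 1 by omega)
      -- The interval `[-1/2, k - 1/2]` contains exactly the integers `0, …, k - 1`.
      refine ⟨(k - 1) / 2, ?_, ?_, key _ _ 0 k (by simp) ?_ ?_⟩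
      · rw [abs_le]; constructor <;> linarith
      · rw [abs_le]; constructor <;> linarith
      · push_cast; linarith
      · push_cast; linarith
    · have h0 : (x : ℝ) ≤ 0 := by exact_mod_cast hx0
      have h1 : -((k : ℝ) - 1) ≤ x := by exact_mod_cast (show -((k : ℤ) - 1) ≤ x by omega)
      refine ⟨-(k - 1) / 2, ?_, ?_, key _ _ (1 - k) 1 (by simp) ?_ ?_⟩
      · rw [abs_le]; constructor <;> linarith
      · rw [abs_le]; constructor <;> linarith
      · push_cast; linarith
      · push_cast; linarith

theorem exists_cube_card_le_lineCount {e : ℕ} (i : Fin (e + 1)) (p : Fin (e + 1) → ℤ)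
    (m : Fin e → ℤ) : ∃ (x₀ : Fin (e + 1) → ℝ) (r : ℝ), 0 ≤ r ∧ p ∈ cubePoints x₀ r ∧
      i.insertNth (p i) m ∈ cubePoints x₀ r ∧
      (cubePoints x₀ r).card ≤ lineCount (m - i.removeNth p) := by
  set k := latticeSupNorm (m - i.removeNth p) with hk
  have hx : ∀ j, ((i.insertNth (p i) m : Fin (e + 1) → ℤ) j - p j).natAbs ≤ k := by
    rw [i.forall_iff_succAbove]
    refine ⟨by simp, fun j => ?_⟩
    rw [Fin.insertNth_apply_succAbove]
    exact natAbs_le_latticeSupNorm (m - i.removeNth p) j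
  choose c hc0 hcx hc using fun j => exists_interval_center k _ (hx j)
  have hr : (0 : ℝ) ≤ k / 2 := by positivity
  refine ⟨fun j => p j + c j, k / 2, hr, (mem_cubePoints hr).mpr fun j => ?_,
    (mem_cubePoints hr).mpr fun j => ?_, ?_⟩
  · convert hc0 j using 2; ring
  · convert hcx j using 2; push_cast; ring
  · rw [card_cubePoints hr, Fin.prod_univ_succAbove _ i, lineCount, ← hk]
    refine Nat.mul_le_mul ((hc i (p i)).trans ?_) (Finset.prod_le_prod' fun j _ => ?_)
    · rw [Fin.insertNth_apply_same, sub_self, Int.natAbs_zero]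
      split_ifs <;> omega
    · refine (hc (i.succAbove j) (p (i.succAbove j))).trans (le_of_eq ?_)
      rw [Fin.insertNth_apply_succAbove]
      rfl

end Cubes

/-! ### Attainment of the supremum -/

section Maximal

variable {d : ℕ} {f : (Fin d → ℤ) → ℝ}

theorem cubeAverage_nonneg (f : (Fin d → ℤ) → ℝ) (x₀ : Fin d → ℝ) (r : ℝ) :
    0 ≤ cubeAverage f x₀ r :=
  mul_nonneg (by positivity) (Finset.sum_nonneg fun _ _ => abs_nonneg _)

theorem mem_cubePoints_iff_latticePoint {x₀ : Fin d → ℝ} {r : ℝ} {n : Fin d → ℤ} :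
    n ∈ cubePoints x₀ r ↔ latticePoint n ∈ Metric.closedBall x₀ r := by
  simp [cubePoints]

theorem cubeAverage_le_uncenteredMaximal (hf : Summable fun m => |f m|) {x₀ : Fin d → ℝ} {r : ℝ}
    (hr : 0 ≤ r) {n : Fin d → ℤ} (hn : n ∈ cubePoints x₀ r) :
    cubeAverage f x₀ r ≤ uncenteredMaximal f n :=
  le_csSup (bddAbove_cubeAverages f hf n)
    ⟨x₀, r, hr, mem_cubePoints_iff_latticePoint.mp hn, rfl⟩

theorem uncenteredMaximal_nonneg (f : (Fin d → ℤ) → ℝ) (n : Fin d → ℤ) :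
    0 ≤ uncenteredMaximal f n := by
  apply Real.sSup_nonneg
  rintro a ⟨x₀, r, -, -, rfl⟩
  exact cubeAverage_nonneg f x₀ r

/-- For summable `f` the supremum defining the maximal function is attained. -/
theorem exists_cubeAverage_eq_uncenteredMaximal (hf : Summable fun m => |f m|) (n : Fin d → ℤ) :
    ∃ (x₀ : Fin d → ℝ) (r : ℝ), 0 ≤ r ∧ n ∈ cubePoints x₀ r ∧
      uncenteredMaximal f n = cubeAverage f x₀ r := by
  rcases (uncenteredMaximal_nonneg f n).eq_or_lt with h0 | hpos
  · have hn : n ∈ cubePoints (latticePoint n) 0 := by simp [mem_cubePoints_iff_latticePoint]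
    refine ⟨latticePoint n, 0, le_rfl, hn, le_antisymm ?_
      (cubeAverage_le_uncenteredMaximal hf le_rfl hn)⟩
    rw [← h0]
    exact cubeAverage_nonneg _ _ _
  set M := uncenteredMaximal f n with hM
  set S := cubeAverages f n ∩ {a | M / 2 < a} with hS
  -- An average above `M / 2` comes from a cube with fewer than `N` lattice points, hence inside a
  -- fixed box about `n`. Only finitely many such averages exist.
  obtain ⟨N, hN⟩ := exists_nat_gt (2 * (∑' m, |f m|) / M)
  have hfin : S.Finite := by
    refine (((Finset.Icc (n - fun _ => (N : ℤ)) (n + fun _ => (N : ℤ))).powerset.image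
      fun Q : Finset (Fin d → ℤ) => (1 / (Q.card : ℝ)) * ∑ m ∈ Q, |f m|).finite_toSet).subset ?_
    rintro a ⟨⟨x₀, r, hr, hn, rfl⟩, ha⟩
    rw [Finset.mem_coe, Finset.mem_image]
    refine ⟨cubePoints x₀ r, ?_, rfl⟩
    rw [← mem_cubePoints_iff_latticePoint] at hn
    have hcard : (0 : ℝ) < (cubePoints x₀ r).card := by
      exact_mod_cast Finset.card_pos.mpr ⟨n, hn⟩
    have hsum : ∑ m ∈ cubePoints x₀ r, |f m| ≤ ∑' m, |f m| :=
      hf.sum_le_tsum _ fun _ _ => abs_nonneg _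
    have hlt : (cubePoints x₀ r).card < N := by
      have ha' : M / 2 < (1 / ((cubePoints x₀ r).card : ℝ)) * ∑ m ∈ cubePoints x₀ r, |f m| := ha
      rw [one_div_mul_eq_div, lt_div_iff₀ hcard] at ha'
      have : ((cubePoints x₀ r).card : ℝ) < N := by
        refine lt_of_lt_of_le ?_ hN.le
        rw [lt_div_iff₀ hpos]
        linarith
      exact_mod_cast this
    rw [Finset.mem_powerset]
    intro q hq
    rw [Finset.mem_Icc]
    refine ⟨fun j => ?_, fun j => ?_⟩
    all_goals
      have := natAbs_sub_lt_card hr hq hn j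
      simp only [Pi.sub_apply, Pi.add_apply]
      omega
  have hne : S.Nonempty := by
    obtain ⟨a, ha, hlt⟩ := exists_lt_of_lt_csSup (cubeAverages_nonempty f n)
      (show M / 2 < sSup (cubeAverages f n) from half_lt_self hpos)
    exact ⟨a, ha, hlt⟩
  obtain ⟨b, ⟨⟨x₀, r, hr, hn, rfl⟩, hb⟩, hmax⟩ := hfin.exists_maximal hne
  refine ⟨x₀, r, hr, mem_cubePoints_iff_latticePoint.mpr hn, le_antisymm ?_
    (cubeAverage_le_uncenteredMaximal hf hr (mem_cubePoints_iff_latticePoint.mpr hn))⟩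
  refine csSup_le (cubeAverages_nonempty f n) fun a ha => ?_
  by_contra hlt
  rw [not_le] at hlt
  exact hlt.not_ge (hmax ⟨ha, lt_trans hb hlt⟩ hlt.le)

end Maximal

/-! ### The sum of the line weights and the sharp constant -/

section SharpConstant

/-- The supremum along a line of the maximal function of a delta function, in terms of the
displacement transversal to the line. -/
noncomputable def lineWeight {e : ℕ} (m : Fin e → ℤ) : ℝ := (lineCount m : ℝ)⁻¹

theorem lineWeight_pos {e : ℕ} (m : Fin e → ℤ) : 0 < lineWeight m :=
  inv_pos.mpr (by exact_mod_cast lineCount_pos m)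

theorem lineWeight_le_one {e : ℕ} (m : Fin e → ℤ) : lineWeight m ≤ 1 :=
  inv_le_one_of_one_le₀ (by exact_mod_cast lineCount_pos m)

theorem lineWeight_zero {e : ℕ} : lineWeight (0 : Fin e → ℤ) = 1 := by
  simp [lineWeight, lineCount_zero]

theorem latticeSupNorm_le_iff {e : ℕ} {m : Fin e → ℤ} {k : ℕ} :
    latticeSupNorm m ≤ k ↔ m ∈ Fintype.piFinset fun _ => Finset.Icc (-(k : ℤ)) k := by
  simp only [latticeSupNorm, Finset.sup_le_iff, Finset.mem_univ, forall_true_left,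
    Fintype.mem_piFinset, Finset.mem_Icc]
  exact forall_congr' fun j => by omega

theorem preimage_latticeSupNorm_succ (e k : ℕ) :
    (latticeSupNorm : (Fin e → ℤ) → ℕ) ⁻¹' {k + 1} =
      ↑((Fintype.piFinset fun _ : Fin e => Finset.Icc (-((k + 1 : ℕ) : ℤ)) (k + 1 : ℕ)) \
        Fintype.piFinset fun _ : Fin e => Finset.Icc (-(k : ℤ)) k) := by
  ext m
  rw [Finset.mem_coe, Finset.mem_sdiff, ← latticeSupNorm_le_iff, ← latticeSupNorm_le_iff,
    Set.mem_preimage, Set.mem_singleton_iff]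
  omega

/-- On the shell of sup norm `k + 1` the weight is a product of one-variable functions. The same
product sums to a power over each of the two boxes, and the shell is their difference. -/
theorem sum_shell_lineWeight (e k : ℕ) :
    ∑ m ∈ (Fintype.piFinset fun _ : Fin e => Finset.Icc (-((k + 1 : ℕ) : ℤ)) (k + 1 : ℕ)) \
        Fintype.piFinset fun _ : Fin e => Finset.Icc (-(k : ℤ)) k, lineWeight m =
      sharpConstTerm (e + 1) k.succPNat := by
  set h : ℤ → ℝ := fun x => if x.natAbs = k + 1 then ((k : ℝ) + 1 + 1)⁻¹ else ((k : ℝ) + 1)⁻¹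
    with hh
  have hw : ∀ m ∈ (Fintype.piFinset fun _ : Fin e => Finset.Icc (-((k + 1 : ℕ) : ℤ)) (k + 1 : ℕ)) \
      Fintype.piFinset fun _ : Fin e => Finset.Icc (-(k : ℤ)) k,
      lineWeight m = ((k : ℝ) + 1)⁻¹ * ∏ j, h (m j) := by
    intro m hm
    have hk : latticeSupNorm m = k + 1 := by
      have : m ∈ (latticeSupNorm : (Fin e → ℤ) → ℕ) ⁻¹' {k + 1} := by
        rw [preimage_latticeSupNorm_succ]; exact hm
      exact this
    rw [lineWeight, lineCount, hk, max_eq_left (by omega)]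
    push_cast
    rw [mul_inv, ← Finset.prod_inv_distrib]
    congr 1
    refine Finset.prod_congr rfl fun j _ => ?_
    simp only [hh]
    split_ifs <;> rfl
  have hsmall : ∑ x ∈ Finset.Icc (-(k : ℤ)) k, h x = (2 * (k + 1) - 1) / (k + 1) := by
    rw [Finset.sum_congr rfl (g := fun _ => ((k : ℝ) + 1)⁻¹)]
    · rw [Finset.sum_const, Int.card_Icc, nsmul_eq_mul, div_eq_mul_inv,
        show ((k : ℤ) + 1 - -k).toNat = 2 * k + 1 by omega]
      push_cast
      ring
    · intro x hx
      rw [Finset.mem_Icc] at hx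
      simp only [hh]
      rw [if_neg (by omega)]
  have hbig : ∑ x ∈ Finset.Icc (-((k + 1 : ℕ) : ℤ)) (k + 1 : ℕ), h x =
      2 / (k + 1 + 1) + (2 * (k + 1) - 1) / (k + 1) := by
    have hIcc : Finset.Icc (-((k + 1 : ℕ) : ℤ)) (k + 1 : ℕ) =
        insert ((k : ℤ) + 1) (insert (-((k : ℤ) + 1)) (Finset.Icc (-(k : ℤ)) k)) := by
      ext x
      simp only [Finset.mem_insert, Finset.mem_Icc]
      omega
    rw [hIcc, Finset.sum_insert, Finset.sum_insert, hsmall]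
    · have h1 : h ((k : ℤ) + 1) = ((k : ℝ) + 1 + 1)⁻¹ := if_pos (by omega)
      have h2 : h (-((k : ℤ) + 1)) = ((k : ℝ) + 1 + 1)⁻¹ := if_pos (by omega)
      rw [h1, h2]
      ring
    · simp
    · simp only [Finset.mem_insert, Finset.mem_Icc]
      omega
  rw [Finset.sum_congr rfl hw, ← Finset.mul_sum, Finset.sum_sdiff_eq_sub, ← Finset.prod_univ_sum,
    ← Finset.prod_univ_sum, Finset.prod_const, Finset.prod_const, hsmall, hbig, sharpConstTerm]
  · simp
  · exact Fintype.piFinset_subset _ _ fun _ => Finset.Icc_subset_Icc (by omega) (by omega)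

theorem sharpConstTerm_nonneg (d : ℕ) (k : ℕ+) : 0 ≤ sharpConstTerm d k := by
  have hk : (1 : ℝ) ≤ k := by exact_mod_cast k.pos
  have h1 : 0 ≤ (2 * (k : ℝ) - 1) / k := div_nonneg (by linarith) (by linarith)
  have h2 : 0 ≤ 2 / ((k : ℝ) + 1) := by positivity
  refine mul_nonneg (by positivity) (sub_nonneg.mpr ?_)
  gcongr
  linarith

/-- The two bases differ by at most `2 / k` and are at most 3, so the term is `O(1 / k ^ 2)`. -/
theorem summable_sharpConstTerm (d : ℕ) : Summable (sharpConstTerm d) := by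
  have hs : Summable fun k : ℕ+ => (2 * (d - 1 : ℕ) * 3 ^ (d - 1 - 1) : ℝ) * (1 / (k : ℝ) ^ 2) := by
    apply Summable.mul_left
    exact (Real.summable_one_div_nat_pow.mpr one_lt_two).comp_injective PNat.coe_injective
  refine hs.of_nonneg_of_le (sharpConstTerm_nonneg d) fun k => ?_
  have hk : (1 : ℝ) ≤ k := by exact_mod_cast k.pos
  have hk0 : (0 : ℝ) < k := by linarith
  set b : ℝ := (2 * (k : ℝ) - 1) / k with hb
  set a : ℝ := 2 / ((k : ℝ) + 1) with ha
  have hb0 : 0 ≤ b := div_nonneg (by linarith) hk0.le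
  have hb2 : b ≤ 2 := by rw [hb, div_le_iff₀ hk0]; linarith
  have ha0 : 0 ≤ a := by positivity
  have ha1 : a ≤ 1 := by rw [ha, div_le_one (by linarith)]; linarith
  have hak : a ≤ 2 / k := by rw [ha]; gcongr; linarith
  have hpow : (a + b) ^ (d - 1) - b ^ (d - 1) ≤ a * (d - 1 : ℕ) * 3 ^ (d - 1 - 1) := by
    have h := (le_abs_self _).trans (abs_pow_sub_pow_le (a + b) b (d - 1))
    rw [add_sub_cancel_right, abs_of_nonneg ha0, abs_of_nonneg hb0,
      abs_of_nonneg (by linarith : 0 ≤ a + b), max_eq_left (by linarith)] at h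
    refine h.trans ?_
    gcongr
    linarith
  calc sharpConstTerm d k = 1 / k * ((a + b) ^ (d - 1) - b ^ (d - 1)) := rfl
    _ ≤ 1 / k * (2 / k * (d - 1 : ℕ) * 3 ^ (d - 1 - 1)) := by
        gcongr
        exact hpow.trans (by gcongr)
    _ = _ := by ring

theorem one_add_tsum_sharpConstTerm_pos (d : ℕ) : 0 < 1 + ∑' k, sharpConstTerm d k := by
  have : 0 ≤ ∑' k, sharpConstTerm d k := tsum_nonneg (sharpConstTerm_nonneg d)
  linarith

theorem tsum_lineWeight (e : ℕ) :
    ∑' m : Fin e → ℤ, ENNReal.ofReal (lineWeight m) =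
      ENNReal.ofReal (1 + ∑' k, sharpConstTerm (e + 1) k) := by
  rw [← ENNReal.tsum_fiberwise _ (latticeSupNorm : (Fin e → ℤ) → ℕ),
    tsum_eq_zero_add' ENNReal.summable,
    ENNReal.ofReal_add zero_le_one (tsum_nonneg (sharpConstTerm_nonneg _)),
    ENNReal.ofReal_tsum_of_nonneg (sharpConstTerm_nonneg _) (summable_sharpConstTerm _)]
  congr 1
  · have h0 : (latticeSupNorm : (Fin e → ℤ) → ℕ) ⁻¹' {0} = {0} := by
      ext m
      rw [Set.mem_preimage, Set.mem_singleton_iff, Set.mem_singleton_iff]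
      refine ⟨fun h => funext fun j => ?_, fun h => by simp [h, latticeSupNorm]⟩
      have := natAbs_le_latticeSupNorm m j
      rw [h] at this
      exact Int.natAbs_eq_zero.mp (Nat.le_zero.mp this)
    rw [h0, tsum_singleton (f := fun m => ENNReal.ofReal (lineWeight m)), lineWeight_zero]
  · rw [← Equiv.pnatEquivNat.symm.tsum_eq]
    refine tsum_congr fun k => ?_
    rw [preimage_latticeSupNorm_succ,
      Finset.tsum_subtype' _ fun m => ENNReal.ofReal (lineWeight m),
      ← ENNReal.ofReal_sum_of_nonneg fun m _ => (lineWeight_pos m).le, sum_shell_lineWeight]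
    rfl

theorem sharpConst_one : sharpConst 1 = 2 := by
  simp [sharpConst, sharpConstTerm]

theorem sharpConst_two : sharpConst 2 = 12 := by
  -- For `d = 2` the series telescopes.
  have hterm : ∀ k : ℕ, sharpConstTerm 2 k.succPNat = 2 * (1 / ((k : ℝ) + 1)) -
      2 * (1 / (((k + 1 : ℕ) : ℝ) + 1)) := by
    intro k
    have h1 : (k : ℝ) + 1 ≠ 0 := by positivity
    have h2 : (k : ℝ) + 1 + 1 ≠ 0 := by positivity
    simp only [sharpConstTerm, Nat.succPNat_coe, Nat.succ_eq_add_one, Nat.cast_add, Nat.cast_one,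
      Nat.add_one_sub_one, pow_one, add_sub_cancel_right]
    field_simp
    ring
  have hsum : HasSum (fun k : ℕ => sharpConstTerm 2 k.succPNat) 2 := by
    rw [hasSum_iff_tendsto_nat_of_nonneg fun k => sharpConstTerm_nonneg 2 _]
    simp_rw [hterm]
    have hlim : Filter.Tendsto (fun n : ℕ => 2 - 2 * (1 / ((n : ℝ) + 1))) Filter.atTop
        (nhds (2 - 2 * 0)) :=
      (tendsto_one_div_add_atTop_nhds_zero_nat.const_mul 2).const_sub 2
    rw [mul_zero, sub_zero] at hlim
    refine hlim.congr fun n => ?_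
    rw [Finset.sum_range_sub' (fun k : ℕ => 2 * (1 / ((k : ℝ) + 1)))]
    simp
  have htsum : ∑' k, sharpConstTerm 2 k = 2 := by
    rw [← Equiv.pnatEquivNat.symm.tsum_eq]
    exact hsum.tsum_eq
  rw [sharpConst, htsum]
  norm_num

end SharpConstant

/-! ### Mass to the left of a hyperplane -/

section LeftMass

variable {d : ℕ} {F : (Fin d → ℤ) → ℝ}

/-- The mass of `F` on the open half space `{q | q i < s}`. -/
noncomputable def leftMass (F : (Fin d → ℤ) → ℝ) (i : Fin d) (s : ℤ) : ℝ :=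
  ∑' q, if q i < s then F q else 0

theorem summable_ite_of_nonneg (hF : ∀ q, 0 ≤ F q) (hs : Summable F) (P : (Fin d → ℤ) → Prop)
    [DecidablePred P] : Summable fun q => if P q then F q else 0 :=
  hs.of_nonneg_of_le (fun q => by split_ifs <;> simp [hF]) fun q => by split_ifs <;> simp [hF]

theorem leftMass_nonneg (hF : ∀ q, 0 ≤ F q) (i : Fin d) (s : ℤ) : 0 ≤ leftMass F i s :=
  tsum_nonneg fun q => by split_ifs <;> simp [hF]

theorem leftMass_le_tsum (hF : ∀ q, 0 ≤ F q) (hs : Summable F) (i : Fin d) (s : ℤ) :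
    leftMass F i s ≤ ∑' q, F q :=
  (summable_ite_of_nonneg hF hs _).tsum_le_tsum (fun q => by split_ifs <;> simp [hF]) hs

theorem leftMass_add_sum_le (hF : ∀ q, 0 ≤ F q) (hs : Summable F) (i : Fin d) {l r : ℤ}
    (hlr : l ≤ r) (S : Finset (Fin d → ℤ)) (hS : ∀ q ∈ S, l ≤ q i ∧ q i < r) :
    leftMass F i l + ∑ q ∈ S, F q ≤ leftMass F i r := by
  classical
  have hsum : ∑ q ∈ S, F q = ∑' q, if q ∈ S then F q else 0 := by
    rw [tsum_eq_sum (s := S) fun q hq => if_neg hq]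
    exact Finset.sum_congr rfl fun q hq => (if_pos hq).symm
  have h1 := summable_ite_of_nonneg hF hs fun q => q i < l
  have h2 := summable_ite_of_nonneg hF hs fun q => q ∈ S
  rw [hsum, leftMass, leftMass, ← h1.tsum_add h2]
  refine (h1.add h2).tsum_le_tsum (fun q => ?_) (summable_ite_of_nonneg hF hs _)
  have := hF q
  by_cases hq : q ∈ S
  · obtain ⟨hl, hr⟩ := hS q hq
    simp [hq, hr, not_lt.mpr hl]
  · by_cases hl : q i < l
    · simp [hq, hl, hl.trans_le hlr]
    · simp only [hq, hl, if_false, add_zero]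
      split_ifs <;> simp [this]

theorem leftMass_mono (hF : ∀ q, 0 ≤ F q) (hs : Summable F) (i : Fin d) :
    Monotone (leftMass F i) := fun l r hlr => by
  simpa using leftMass_add_sum_le hF hs i hlr ∅ (by simp)

end LeftMass

/-! ### The upper bound on each line, and its strict form -/

section Lines

variable {e : ℕ} {f : (Fin (e + 1) → ℤ) → ℝ}

theorem totalVariation_eq_sum_lines (g : (Fin (e + 1) → ℤ) → ℝ) :
    totalVariation g = ∑ i : Fin (e + 1), ∑' m : Fin e → ℤ, ∑' t : ℤ,
      ENNReal.ofReal |g (i.insertNth (t + 1) m) - g (i.insertNth t m)| := by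
  refine Finset.sum_congr rfl fun i _ => ?_
  rw [← (Fin.insertNthEquiv (fun _ => ℤ) i).tsum_eq, ENNReal.tsum_prod', ENNReal.tsum_comm]
  refine tsum_congr fun m => tsum_congr fun t => ?_
  have h : (i.insertNth t m : Fin (e + 1) → ℤ) + Pi.single i 1 = i.insertNth (t + 1) m := by
    ext j
    rcases i.eq_self_or_eq_succAbove j with rfl | ⟨j, rfl⟩
    · simp
    · simp
  rw [← h]
  rfl

/-- The mass that a lattice point contributes to the line `{i.insertNth t m | t}`. -/
noncomputable def lineMass (f : (Fin (e + 1) → ℤ) → ℝ) (i : Fin (e + 1)) (m : Fin e → ℤ)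
    (q : Fin (e + 1) → ℤ) : ℝ :=
  |f q| * lineWeight (i.removeNth q - m)

theorem lineMass_nonneg (f : (Fin (e + 1) → ℤ) → ℝ) (i : Fin (e + 1)) (m : Fin e → ℤ)
    (q : Fin (e + 1) → ℤ) : 0 ≤ lineMass f i m q :=
  mul_nonneg (abs_nonneg _) (lineWeight_pos _).le

theorem summable_lineMass (hf : Summable fun q => |f q|) (i : Fin (e + 1)) (m : Fin e → ℤ) :
    Summable (lineMass f i m) :=
  hf.of_nonneg_of_le (lineMass_nonneg f i m) fun _ =>
    mul_le_of_le_one_right (abs_nonneg _) (lineWeight_le_one _)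

/-- `[l, r]` is the projection of an optimal cube to the axis `i`. At each point of the line inside
that cube, the same average is a competitor for the supremum. -/
theorem exists_maximal_cube (hf : Summable fun q => |f q|) (i : Fin (e + 1)) (m : Fin e → ℤ)
    (a : ℤ) : ∃ (Q : Finset (Fin (e + 1) → ℤ)) (l r : ℤ), l ≤ a ∧ a ≤ r ∧
      (∀ t, l ≤ t → t ≤ r →
        uncenteredMaximal f (i.insertNth a m) ≤ uncenteredMaximal f (i.insertNth t m)) ∧
      (∀ q ∈ Q, l ≤ q i ∧ q i < r + 1) ∧ i.insertNth a m ∈ Q ∧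
      uncenteredMaximal f (i.insertNth a m) = (1 / (Q.card : ℝ)) * ∑ q ∈ Q, |f q| ∧
      ∀ q ∈ Q, 1 / (Q.card : ℝ) ≤ lineWeight (i.removeNth q - m) := by
  obtain ⟨x₀, r, hr, ha, hmax⟩ := exists_cubeAverage_eq_uncenteredMaximal hf (i.insertNth a m)
  have hbox : ∀ q, q ∈ cubePoints x₀ r ↔ ∀ j, ⌈x₀ j - r⌉ ≤ q j ∧ q j ≤ ⌊x₀ j + r⌋ := by
    intro q
    simp only [cubePoints_eq_piFinset hr, Fintype.mem_piFinset, Finset.mem_Icc]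
  have ha' := (hbox _).mp ha
  have hai := ha' i
  rw [Fin.insertNth_apply_same] at hai
  refine ⟨cubePoints x₀ r, ⌈x₀ i - r⌉, ⌊x₀ i + r⌋, hai.1, hai.2, fun t hl hr' => ?_,
    fun q hq => ?_, ha, hmax, fun q hq => ?_⟩
  · rw [hmax]
    refine cubeAverage_le_uncenteredMaximal hf hr ((hbox _).mpr ?_)
    rw [i.forall_iff_succAbove]
    refine ⟨by simpa using ⟨hl, hr'⟩, fun j => ?_⟩
    simpa using ha' (i.succAbove j)
  · have := (hbox q).mp hq i
    omega
  · have h := lineCount_le_card i hr hq ha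
    rw [Fin.removeNth_insertNth] at h
    rw [lineWeight, one_div]
    exact inv_anti₀ (by exact_mod_cast lineCount_pos _) (by exact_mod_cast h)

theorem intervalDominated_leftMass (hf : Summable fun q => |f q|) (i : Fin (e + 1))
    (m : Fin e → ℤ) : IntervalDominated (fun t => uncenteredMaximal f (i.insertNth t m))
      (leftMass (lineMass f i m) i) := by
  intro a
  obtain ⟨Q, l, r, hl, hr, hlr, hQ, -, hmax, hw⟩ := exists_maximal_cube hf i m a
  refine ⟨l, r, hl, hr, hlr, le_trans ?_ (leftMass_add_sum_le (lineMass_nonneg f i m)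
    (summable_lineMass hf i m) i (by omega) Q hQ)⟩
  simp only
  rw [hmax, Finset.mul_sum]
  gcongr with q hq
  rw [mul_comm, lineMass]
  exact mul_le_mul_of_nonneg_left (hw q hq) (abs_nonneg _)

theorem line_variation_le (hf : Summable fun q => |f q|) (i : Fin (e + 1)) (m : Fin e → ℤ) :
    ∑' t : ℤ, ENNReal.ofReal |uncenteredMaximal f (i.insertNth (t + 1) m) -
      uncenteredMaximal f (i.insertNth t m)| ≤ ENNReal.ofReal (2 * ∑' q, lineMass f i m q) := by
  have hF := lineMass_nonneg f i m
  have hs := summable_lineMass hf i m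
  exact tsum_ofReal_abs_sub_le (g := fun t => uncenteredMaximal f (i.insertNth t m))
    (p := 0) (q := 0) (fun t => uncenteredMaximal_nonneg _ _) fun A N _ _ =>
    partialVariation_le (fun t => uncenteredMaximal_nonneg _ _) (leftMass_mono hF hs i)
      (leftMass_nonneg hF i) (leftMass_le_tsum hF hs i) (intervalDominated_leftMass hf i m) A N

theorem uncenteredMaximal_pos {d : ℕ} {f : (Fin d → ℤ) → ℝ} (hf : Summable fun q => |f q|)
    {p : Fin d → ℤ} (hp : f p ≠ 0) (n : Fin d → ℤ) : 0 < uncenteredMaximal f n := by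
  set r := dist (latticePoint p) (latticePoint n)
  have hr : 0 ≤ r := dist_nonneg
  have hn : n ∈ cubePoints (latticePoint n) r := by
    rw [mem_cubePoints_iff_latticePoint]; exact Metric.mem_closedBall_self hr
  have hpQ : p ∈ cubePoints (latticePoint n) r := by
    rw [mem_cubePoints_iff_latticePoint]; exact Metric.mem_closedBall.mpr le_rfl
  refine lt_of_lt_of_le ?_ (cubeAverage_le_uncenteredMaximal hf hr hn)
  refine mul_pos (one_div_pos.mpr ?_) (Finset.sum_pos' (fun _ _ => abs_nonneg _)
    ⟨p, hpQ, abs_pos.mpr hp⟩)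
  exact_mod_cast Finset.card_pos.mpr ⟨n, hn⟩

/-- A second point in the support makes the bound strict on the line through the first one. -/
theorem line_variation_lt (hf : Summable fun q => |f q|) {i : Fin (e + 1)}
    {p q : Fin (e + 1) → ℤ} (hp : f p ≠ 0) (hq : f q ≠ 0) (hpq : p i < q i) :
    ∑' t : ℤ, ENNReal.ofReal |uncenteredMaximal f (i.insertNth (t + 1) (i.removeNth p)) -
      uncenteredMaximal f (i.insertNth t (i.removeNth p))| <
        ENNReal.ofReal (2 * ∑' q, lineMass f i (i.removeNth p) q) := by
  classical
  set m := i.removeNth p with hm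
  have hF := lineMass_nonneg f i m
  have hs := summable_lineMass hf i m
  have hFp : lineMass f i m p = |f p| := by rw [lineMass, sub_self, lineWeight_zero, mul_one]
  have hFq : 0 < lineMass f i m q := mul_pos (abs_pos.mpr hq) (lineWeight_pos _)
  obtain ⟨t₀, -, ht₀⟩ := Finset.exists_min_image (Finset.Icc (p i) (q i))
    (fun t => uncenteredMaximal f (i.insertNth t m)) ⟨p i, Finset.mem_Icc.mpr ⟨le_rfl, hpq.le⟩⟩
  -- The three bounds on `δ` serve the valley, the descent past `q`, and the extension of an
  -- interval to `p`.
  obtain ⟨δ, hδ0, hδt, hδq, hδp⟩ : ∃ δ : ℝ, 0 < δ ∧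
      δ ≤ uncenteredMaximal f (i.insertNth t₀ m) ∧ δ ≤ lineMass f i m q ∧ δ ≤ |f p| / 2 :=
    ⟨min (uncenteredMaximal f (i.insertNth t₀ m)) (min (lineMass f i m q) (|f p| / 2)),
      lt_min (uncenteredMaximal_pos hf hp _) (lt_min hFq (half_pos (abs_pos.mpr hp))),
      min_le_left _ _, (min_le_right _ _).trans (min_le_left _ _),
      (min_le_right _ _).trans (min_le_right _ _)⟩
  have hgain : ∀ a, q i ≤ a → ∃ l r, l ≤ a ∧ a ≤ r ∧
      (∀ t, l ≤ t → t ≤ r →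
        uncenteredMaximal f (i.insertNth a m) ≤ uncenteredMaximal f (i.insertNth t m)) ∧
      leftMass (lineMass f i m) i (min l (p i)) + uncenteredMaximal f (i.insertNth a m) + δ ≤
        leftMass (lineMass f i m) i (r + 1) := by
    intro a ha
    obtain ⟨Q, l, r, hl, hr, hlr, hQ, haQ, hmax, hw⟩ := exists_maximal_cube hf i m a
    refine ⟨l, r, hl, hr, hlr, le_trans ?_ (leftMass_add_sum_le hF hs i
      (show min l (p i) ≤ r + 1 by omega) (insert p Q) ?_)⟩
    · rw [add_assoc]
      gcongr
      rw [hmax, Finset.mul_sum]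
      have hle : ∀ x ∈ Q, 1 / (Q.card : ℝ) * |f x| ≤ lineMass f i m x := fun x hx => by
        rw [mul_comm, lineMass]
        exact mul_le_mul_of_nonneg_left (hw x hx) (abs_nonneg _)
      -- On its own line `p` has the full mass `|f p|`. If `p ∉ Q`, all of it is gained. If `p ∈ Q`,
      -- the cube has a second lattice point on the line, so the average uses at most half of it.
      by_cases hpQ : p ∈ Q
      · rw [Finset.insert_eq_of_mem hpQ, ← Finset.add_sum_erase _ _ hpQ,
          ← Finset.add_sum_erase _ _ hpQ, hFp]
        have hrest := Finset.sum_le_sum fun x (hx : x ∈ Q.erase p) =>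
          hle x (Finset.mem_of_mem_erase hx)
        have hne : p ≠ i.insertNth a m := fun h => by
          have := congrFun h i
          rw [Fin.insertNth_apply_same] at this
          omega
        have hcard : (2 : ℝ) ≤ Q.card := by
          exact_mod_cast Finset.one_lt_card.mpr ⟨p, hpQ, _, haQ, hne⟩
        have hhalf : 1 / (Q.card : ℝ) * |f p| ≤ 1 / 2 * |f p| := by gcongr
        linarith
      · rw [Finset.sum_insert hpQ, hFp]
        have hrest := Finset.sum_le_sum hle
        linarith [abs_nonneg (f p)]
    · intro x hx
      rcases Finset.mem_insert.mp hx with rfl | hx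
      · omega
      · have := hQ x hx
        omega
  have hstep : leftMass (lineMass f i m) i (q i) + δ ≤ leftMass (lineMass f i m) i (q i + 1) := by
    have := leftMass_add_sum_le hF hs i (show q i ≤ q i + 1 by omega) {q} (by simp)
    rw [Finset.sum_singleton] at this
    linarith
  have hle := tsum_ofReal_abs_sub_le (g := fun t => uncenteredMaximal f (i.insertNth t m))
    (p := p i) (q := q i) (T := 2 * (∑' x, lineMass f i m x) - δ)
    (fun t => uncenteredMaximal_nonneg _ _) fun A N hA hN => le_sub_iff_add_le.mpr
      (partialVariation_add_le (Φ := leftMass (lineMass f i m) i)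
        (fun t => uncenteredMaximal_nonneg _ _) (leftMass_mono hF hs i)
        (leftMass_nonneg hF i) (leftMass_le_tsum hF hs i) (intervalDominated_leftMass hf i m) hpq
        (fun t h1 h2 => by
          have := ht₀ t (Finset.mem_Icc.mpr ⟨h1, h2⟩)
          linarith [uncenteredMaximal_nonneg f (i.insertNth t₀ m)])
        hstep hδ0.le hgain hA hN)
  refine hle.trans_lt ((ENNReal.ofReal_lt_ofReal_iff ?_).mpr (by linarith))
  have := hs.le_tsum q fun x _ => hF x
  linarith

end Lines

/-! ### Equality on each line for delta functions -/

section Delta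

theorem ofReal_le_tsum_abs_sub {h : ℕ → ℝ} (h0 : Filter.Tendsto h Filter.atTop (nhds 0)) :
    ENNReal.ofReal (h 0) ≤ ∑' n : ℕ, ENNReal.ofReal |h (n + 1) - h n| := by
  have := edist_le_tsum_of_edist_le_of_tendsto₀ (fun n => ENNReal.ofReal |h (n + 1) - h n|)
    (fun n => by rw [edist_comm, edist_dist, Real.dist_eq]) h0
  refine le_trans ?_ this
  rw [edist_dist, Real.dist_eq, sub_zero]
  exact ENNReal.ofReal_le_ofReal (le_abs_self _)

/-- `g` must climb from 0 to `g s` and return to 0. -/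
theorem two_mul_ofReal_le_tsum_abs_sub {g : ℤ → ℝ} (s : ℤ)
    (htop : Filter.Tendsto (fun n : ℕ => g (s + n)) Filter.atTop (nhds 0))
    (hbot : Filter.Tendsto (fun n : ℕ => g (s - n)) Filter.atTop (nhds 0)) :
    2 * ENNReal.ofReal (g s) ≤ ∑' t : ℤ, ENNReal.ofReal |g (t + 1) - g t| := by
  rw [← (Equiv.addLeft s).tsum_eq, (HasSum.of_nat_of_neg_add_one ENNReal.summable.hasSum
    ENNReal.summable.hasSum).tsum_eq, two_mul]
  refine add_le_add ?_ ?_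
  · have h := ofReal_le_tsum_abs_sub htop
    simp only [Nat.cast_zero, add_zero] at h
    refine h.trans_eq (tsum_congr fun n => ?_)
    rw [Equiv.coe_addLeft, Nat.cast_succ, add_assoc]
  · have h := ofReal_le_tsum_abs_sub hbot
    simp only [Nat.cast_zero, sub_zero] at h
    refine h.trans_eq (tsum_congr fun n => ?_)
    rw [Equiv.coe_addLeft, abs_sub_comm, Nat.cast_succ]
    simp only [← sub_eq_add_neg]
    rw [show s - ((n : ℤ) + 1) + 1 = s - n by ring]

variable {e : ℕ} {f : (Fin (e + 1) → ℤ) → ℝ} {p : Fin (e + 1) → ℤ}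

/-- A cube containing both `a` and `p` has more than `|a i - p i|` lattice points. This gives the
decay along the line. -/
theorem uncenteredMaximal_delta_le (hf : Summable fun q => |f q|) (hp : ∀ q, q ≠ p → f q = 0)
    (i : Fin (e + 1)) (a : Fin (e + 1) → ℤ) :
    uncenteredMaximal f a ≤ |f p| * (1 / (((a i - p i).natAbs : ℝ) + 1)) := by
  obtain ⟨x₀, r, hr, ha, hmax⟩ := exists_cubeAverage_eq_uncenteredMaximal hf a
  rw [hmax, cubeAverage]
  by_cases hpQ : p ∈ cubePoints x₀ r
  · rw [Finset.sum_eq_single_of_mem p hpQ fun q _ hq => by rw [hp q hq, abs_zero], mul_comm]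
    have h := natAbs_sub_lt_card hr ha hpQ i
    gcongr
    exact_mod_cast h
  · rw [Finset.sum_eq_zero fun q hq => by rw [hp q fun h => hpQ (h ▸ hq), abs_zero], mul_zero]
    positivity

/-- At parameter `p i` a cube with the fewest points gives the value `|f p| * lineWeight (m -
i.removeNth p)`. -/
theorem le_line_variation_delta (hf : Summable fun q => |f q|) (hp : ∀ q, q ≠ p → f q = 0)
    (i : Fin (e + 1)) (m : Fin e → ℤ) :
    ENNReal.ofReal (2 * |f p|) * ENNReal.ofReal (lineWeight (m - i.removeNth p)) ≤
      ∑' t : ℤ, ENNReal.ofReal |uncenteredMaximal f (i.insertNth (t + 1) m) -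
        uncenteredMaximal f (i.insertNth t m)| := by
  have hlim : ∀ s : ℕ → ℤ, (∀ n, (s n - p i).natAbs = n) →
      Filter.Tendsto (fun n => uncenteredMaximal f (i.insertNth (s n) m)) Filter.atTop (nhds 0) := by
    intro s hs
    have hz := (tendsto_one_div_add_atTop_nhds_zero_nat (𝕜 := ℝ)).const_mul |f p|
    rw [mul_zero] at hz
    refine squeeze_zero (fun n => uncenteredMaximal_nonneg _ _) (fun n => ?_) hz
    simpa [hs] using uncenteredMaximal_delta_le hf hp i (i.insertNth (s n) m)
  refine le_trans ?_ (two_mul_ofReal_le_tsum_abs_sub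
    (g := fun t => uncenteredMaximal f (i.insertNth t m)) (p i)
    (hlim _ fun n => by omega) (hlim _ fun n => by omega))
  rw [ENNReal.ofReal_mul zero_le_two, ENNReal.ofReal_ofNat, mul_assoc,
    ← ENNReal.ofReal_mul (abs_nonneg _)]
  gcongr
  obtain ⟨x₀, r, hr, hpQ, hQ, hcard⟩ := exists_cube_card_le_lineCount i p m
  refine le_trans ?_ (cubeAverage_le_uncenteredMaximal hf hr hQ)
  rw [cubeAverage, Finset.sum_eq_single_of_mem p hpQ fun q _ hq => by rw [hp q hq, abs_zero],
    mul_comm, lineWeight, one_div]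
  have : (0 : ℝ) < (cubePoints x₀ r).card := by exact_mod_cast Finset.card_pos.mpr ⟨p, hpQ⟩
  gcongr

end Delta

/-! ### Summation over all lines -/

section Total

variable {e : ℕ}

theorem summable_abs_lp (f : lp (fun _ : Fin (e + 1) → ℤ => ℝ) 1) : Summable fun q => |f q| := by
  simpa using (lp.memℓp f).summable (by norm_num)

theorem norm_lp_one_eq_tsum_abs (f : lp (fun _ : Fin (e + 1) → ℤ => ℝ) 1) :
    ‖f‖ = ∑' q, |f q| := by
  rw [lp.norm_eq_tsum_rpow (by norm_num)]
  simp

theorem sharpConst_pos (e : ℕ) : 0 < sharpConst (e + 1) :=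
  mul_pos (by positivity) (one_add_tsum_sharpConstTerm_pos _)

theorem sum_ofReal_two_mul_tsum_lineWeight {c : ℝ} (hc : 0 ≤ c) :
    ∑ _i : Fin (e + 1), ENNReal.ofReal (2 * c) * ∑' m : Fin e → ℤ, ENNReal.ofReal (lineWeight m) =
      ENNReal.ofReal (sharpConst (e + 1) * c) := by
  rw [tsum_lineWeight, ← ENNReal.ofReal_mul (by positivity), Finset.sum_const, Finset.card_univ,
    Fintype.card_fin, nsmul_eq_mul, ← ENNReal.ofReal_natCast,
    ← ENNReal.ofReal_mul (by positivity), sharpConst]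
  congr 1
  ring

/-- After interchanging the sums, the weights seen from each `q` are a reflected translate of the
same family. -/
theorem tsum_lines_lineMass {f : (Fin (e + 1) → ℤ) → ℝ} (hf : Summable fun q => |f q|)
    (i : Fin (e + 1)) :
    ∑' m : Fin e → ℤ, ENNReal.ofReal (2 * ∑' q, lineMass f i m q) =
      ENNReal.ofReal (2 * ∑' q, |f q|) * ∑' m : Fin e → ℤ, ENNReal.ofReal (lineWeight m) := by
  simp_rw [ENNReal.ofReal_mul zero_le_two]
  rw [ENNReal.tsum_mul_left, mul_assoc]
  congr 1
  simp_rw [ENNReal.ofReal_tsum_of_nonneg (lineMass_nonneg f i _) (summable_lineMass hf i _)]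
  rw [ENNReal.tsum_comm, ENNReal.ofReal_tsum_of_nonneg (fun _ => abs_nonneg _) hf,
    ← ENNReal.tsum_mul_right]
  refine tsum_congr fun q => ?_
  simp_rw [lineMass, ENNReal.ofReal_mul (abs_nonneg _)]
  rw [ENNReal.tsum_mul_left,
    ← (Equiv.subLeft (i.removeNth q)).tsum_eq fun m => ENNReal.ofReal (lineWeight m)]
  rfl

theorem sum_lines_lineMass (f : lp (fun _ : Fin (e + 1) → ℤ => ℝ) 1) :
    ∑ i : Fin (e + 1), ∑' m : Fin e → ℤ, ENNReal.ofReal (2 * ∑' q, lineMass f i m q) =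
      ENNReal.ofReal (sharpConst (e + 1) * ‖f‖) := by
  rw [← sum_ofReal_two_mul_tsum_lineWeight (norm_nonneg f), norm_lp_one_eq_tsum_abs]
  exact Finset.sum_congr rfl fun i _ => tsum_lines_lineMass (summable_abs_lp f) i

theorem totalVariation_uncenteredMaximal_le (f : lp (fun _ : Fin (e + 1) → ℤ => ℝ) 1) :
    totalVariation (uncenteredMaximal f) ≤ ENNReal.ofReal (sharpConst (e + 1) * ‖f‖) := by
  rw [totalVariation_eq_sum_lines, ← sum_lines_lineMass]
  exact Finset.sum_le_sum fun i _ => ENNReal.tsum_le_tsum fun m =>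
    line_variation_le (summable_abs_lp f) i m

theorem totalVariation_uncenteredMaximal_lt (f : lp (fun _ : Fin (e + 1) → ℤ => ℝ) 1)
    {i : Fin (e + 1)} {p q : Fin (e + 1) → ℤ} (hp : f p ≠ 0) (hq : f q ≠ 0) (hpq : p i < q i) :
    totalVariation (uncenteredMaximal f) < ENNReal.ofReal (sharpConst (e + 1) * ‖f‖) := by
  have hf := summable_abs_lp f
  -- One strict term makes the whole sum strict only if the smaller sum is finite.
  have hfin : totalVariation (uncenteredMaximal f) ≠ ∞ :=
    ((totalVariation_uncenteredMaximal_le f).trans_lt ENNReal.ofReal_lt_top).ne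
  rw [totalVariation_eq_sum_lines] at hfin ⊢
  rw [← sum_lines_lineMass]
  have hfini := ENNReal.sum_ne_top.mp hfin i (Finset.mem_univ i)
  rw [← tsum_fintype (L := .unconditional _)] at hfin ⊢
  rw [← tsum_fintype (L := .unconditional _)]
  exact ENNReal.tsum_lt_tsum hfin
    (fun j => ENNReal.tsum_le_tsum fun m => line_variation_le hf j m)
    (ENNReal.tsum_lt_tsum hfini (fun m => line_variation_le hf i m)
      (line_variation_lt hf hp hq hpq))

theorem totalVariation_uncenteredMaximal_of_isDeltaFunction
    (f : lp (fun _ : Fin (e + 1) → ℤ => ℝ) 1) (hδ : IsDeltaFunction f) :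
    totalVariation (uncenteredMaximal f) = ENNReal.ofReal (sharpConst (e + 1) * ‖f‖) := by
  obtain ⟨p, k, -, hp⟩ := hδ
  refine le_antisymm (totalVariation_uncenteredMaximal_le f) ?_
  have hnorm : ‖f‖ = |f p| := by
    rw [norm_lp_one_eq_tsum_abs, tsum_eq_single p fun q hq => by rw [hp q hq, abs_zero]]
  rw [hnorm, ← sum_ofReal_two_mul_tsum_lineWeight (abs_nonneg _), totalVariation_eq_sum_lines]
  refine Finset.sum_le_sum fun i _ => ?_
  rw [← (Equiv.subRight (i.removeNth p)).tsum_eq, ← ENNReal.tsum_mul_left]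
  exact ENNReal.tsum_le_tsum fun m => le_line_variation_delta (summable_abs_lp f) hp i m

theorem isDeltaFunction_of_totalVariation_eq (f : lp (fun _ : Fin (e + 1) → ℤ => ℝ) 1)
    (heq : totalVariation (uncenteredMaximal f) = ENNReal.ofReal (sharpConst (e + 1) * ‖f‖)) :
    IsDeltaFunction f := by
  by_contra hδ
  have hex : ∀ p, ∃ q, q ≠ p ∧ f q ≠ 0 := by
    intro p
    by_contra! h
    exact hδ ⟨p, f p, rfl, h⟩
  -- The point `0` is arbitrary here; it serves only to produce a first support point.
  obtain ⟨p, -, hp⟩ := hex 0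
  obtain ⟨q, hqp, hq⟩ := hex p
  obtain ⟨i, hi⟩ := Function.ne_iff.mp hqp
  rcases hi.lt_or_gt with h | h
  · exact (totalVariation_uncenteredMaximal_lt f hq hp h).ne heq
  · exact (totalVariation_uncenteredMaximal_lt f hp hq h).ne heq

end Total

theorem theorem3 :
    (∀ d : ℕ, 1 ≤ d →
      -- the series defining the constant converges
      Summable (sharpConstTerm d) ∧
      -- the inequality
      (∀ f : lp (fun _ : Fin d → ℤ => ℝ) 1,
        totalVariation (uncenteredMaximal f) ≤ ENNReal.ofReal (sharpConst d * ‖f‖)) ∧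
      -- the constant is the best possible
      (∀ C : ℝ, (∀ f : lp (fun _ : Fin d → ℤ => ℝ) 1,
        totalVariation (uncenteredMaximal f) ≤ ENNReal.ofReal (C * ‖f‖)) → sharpConst d ≤ C) ∧
      -- the equality case
      (∀ f : lp (fun _ : Fin d → ℤ => ℝ) 1,
        totalVariation (uncenteredMaximal f) = ENNReal.ofReal (sharpConst d * ‖f‖) ↔
          IsDeltaFunction f)) ∧
    sharpConst 1 = 2 ∧ sharpConst 2 = 12 := by
  refine ⟨fun d hd => ?_, sharpConst_one, sharpConst_two⟩
  obtain ⟨e, rfl⟩ : ∃ e, d = e + 1 := ⟨d - 1, by omega⟩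
  refine ⟨summable_sharpConstTerm _, totalVariation_uncenteredMaximal_le, fun C hC => ?_,
    fun f => ⟨isDeltaFunction_of_totalVariation_eq f,
      totalVariation_uncenteredMaximal_of_isDeltaFunction f⟩⟩
  set f : lp (fun _ : Fin (e + 1) → ℤ => ℝ) 1 := lp.single 1 0 1 with hf
  have hδ : IsDeltaFunction f := ⟨0, f 0, rfl, fun n hn => by
    rw [hf, lp.single_apply_ne _ _ _ hn]⟩
  have hnorm : ‖f‖ = 1 := by rw [hf, lp.norm_single one_pos, norm_one]
  have h := hC f
  rw [totalVariation_uncenteredMaximal_of_isDeltaFunction f hδ, hnorm, mul_one, mul_one] at h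
  by_contra! hlt
  -- Positivity of the constant matters: `ENNReal.ofReal` would truncate a negative `C` to 0.
  exact h.not_gt ((ENNReal.ofReal_lt_ofReal_iff (sharpConst_pos e)).mpr hlt)
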